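/- For integers $d\ge 2$ and $n\ge 0$ let $H_d(n)$ denote the number of permutations $\sigma\in S_n$ that are products of pairwise disjoint cycles of length $d$ (the identity is counted, as the empty product). For every prime number $p$ and every positive integer $w$, the numbers $$\frac{H_p(n)}{p^{\lfloor n/p^2\rfloor (p-1)}},\qquad n=0,1,2,\dots,$$ are integers, and the sequence $$\left(\frac{H_p(n)}{p^{\lfloor n/p^2\rfloor (p-1)}}\bmod p^w\right)_{n\ge 0}$$ is periodic with period $p^{2w+1}(p-1)$ (not necessarily the least one); that is, for all $n\ge0$ the $n$-th and the $(n+p^{2w+1}(p-1))$-th terms are equal. -/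

import Mathlib

/-- A permutation is a product of pairwise disjoint cycles of length `d`
(the empty product, that is the identity, is allowed). -/
def IsProdDisjointCycles (d : ℕ) {n : ℕ} (σ : Equiv.Perm (Fin n)) : Prop :=
  ∃ l : List (Equiv.Perm (Fin n)),
    (∀ τ ∈ l, τ.IsCycle ∧ τ.support.card = d) ∧ l.Pairwise Equiv.Perm.Disjoint ∧ l.prod = σ

/-- `cycleProdCount d n` is the number `H_d(n)` of permutations in `S_n` which are products of
pairwise disjoint cycles of length `d`. -/
noncomputable def cycleProdCount (d n : ℕ) : ℕ :=
  Nat.card {σ : Equiv.Perm (Fin n) // IsProdDisjointCycles d σ}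

/-! Let `E_N = exp (∑ j < N, X^(p^j) / p^j)`. Counting by cycle type gives `∑ H_p(n) X^n / n! =
E_2`, and `E_2 = E_3 * exp (-X^(p^2) / p^2)`.

Dwork's criterion, resting on `G^p ≡ G(X^p)` mod `p`, makes `E_N` integral below degree `p^N`.
Dividing by the factors with `j ≥ 3` shows that the coefficients `c_m` of `E_3` have denominators at
most `p^(2⌊m/p^2⌋)`; so `d_i = p^(2i) c_{p^2 i + r}` lies in `ℤ_p`.

For `n = p^2 k + r` with `r < p^2`, `n!` is `p^(k(p-1)) p^⌊r/p⌋ p^(2k) k!` times a unit. The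
quotient is therefore `p^⌊r/p⌋` times a unit times `(-1)^k ∑ (-1)^i k(k-1)⋯(k-i+1) d_i`
(`exists_cycleProdCount_eq`). This gives integrality, and each factor is periodic in `k` modulo
`p^w` (`quotientFormula_add_sub_dvd`). -/

theorem Polynomial.exists_pow_eq_expand_add {p : ℕ} [hp : Fact p.Prime] (G : Polynomial ℤ_[p]) :
    ∃ K : Polynomial ℤ_[p], G ^ p = Polynomial.expand ℤ_[p] p G + Polynomial.C (p : ℤ_[p]) * K := by
  have h : Polynomial.map PadicInt.toZMod (G ^ p - Polynomial.expand ℤ_[p] p G) = 0 := by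
    rw [Polynomial.map_sub, Polynomial.map_pow, Polynomial.map_expand, ZMod.expand_card, sub_self]
  have h2 : Polynomial.C (p : ℤ_[p]) ∣ G ^ p - Polynomial.expand ℤ_[p] p G := by
    rw [Polynomial.C_dvd_iff_dvd_coeff]
    intro i
    have h3 := congrArg (fun q => Polynomial.coeff q i) h
    simp only [Polynomial.coeff_map, Polynomial.coeff_zero] at h3
    rw [← RingHom.mem_ker, PadicInt.ker_toZMod, PadicInt.maximalIdeal_eq_span_p,
      Ideal.mem_span_singleton] at h3
    exact h3
  obtain ⟨K, hK⟩ := h2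
  exact ⟨K, by rw [← hK]; ring⟩

/-! ### Exponential series and Dwork's criterion -/

/-- `expSeries d a` is the power series `exp (a X ^ d)` over `ℚ_p`. -/
noncomputable def expSeries (p : ℕ) [Fact p.Prime] (d : ℕ) [NeZero d] (a : ℚ_[p]) :
    PowerSeries ℚ_[p] :=
  PowerSeries.expand d (NeZero.ne d) (PowerSeries.rescale a (PowerSeries.exp ℚ_[p]))

section
variable {p : ℕ} [hp : Fact p.Prime]
open PowerSeries Finset

theorem coeff_expSeries (d : ℕ) [NeZero d] (a : ℚ_[p]) (n : ℕ) :
    coeff n (expSeries p d a) = if d ∣ n then a ^ (n / d) / (n / d).factorial else 0 := by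
  rw [expSeries, coeff_expand, coeff_rescale, coeff_exp]
  simp [div_eq_mul_inv]

theorem expSeries_mul (d : ℕ) [NeZero d] (a b : ℚ_[p]) :
    expSeries p d a * expSeries p d b = expSeries p d (a + b) := by
  rw [expSeries, expSeries, ← map_mul, exp_mul_exp_eq_exp_add, expSeries]

theorem expSeries_zero (d : ℕ) [NeZero d] : expSeries p d 0 = 1 := by
  simp [expSeries]

theorem expSeries_pow (d : ℕ) [NeZero d] (a : ℚ_[p]) (k : ℕ) :
    expSeries p d a ^ k = expSeries p d (k * a) := by
  induction k with
  | zero => simp [expSeries_zero]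
  | succ k ih => rw [pow_succ, ih, expSeries_mul]; push_cast; ring_nf

theorem expand_expSeries (d e : ℕ) [NeZero d] [NeZero e] (a : ℚ_[p]) :
    PowerSeries.expand e (NeZero.ne e) (expSeries p d a) = expSeries p (e * d) a := by
  rw [expSeries, ← PowerSeries.expand_mul, expSeries]

theorem coeff_mul_expSeries (f : PowerSeries ℚ_[p]) (d : ℕ) [NeZero d] (a : ℚ_[p]) (n : ℕ) :
    coeff n (f * expSeries p d a) =
      ∑ j ∈ range (n / d + 1), coeff (n - d * j) f * (a ^ j / j.factorial) := by
  have hd : 0 < d := Nat.pos_of_ne_zero (NeZero.ne d)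
  rw [mul_comm, coeff_mul, Nat.sum_antidiagonal_eq_sum_range_succ
    (fun i j => coeff i (expSeries p d a) * coeff j f)]
  symm
  refine sum_of_injOn (fun j => d * j) (fun x _ y _ h => Nat.eq_of_mul_eq_mul_left hd h) ?_ ?_ ?_
  · intro j hj
    have hj : j < n / d + 1 := by simpa using hj
    have := (Nat.le_div_iff_mul_le hd).1 (Nat.lt_succ_iff.1 hj)
    simp only [coe_range, Set.mem_Iio]
    lia
  · intro i hi hi'
    rw [coeff_expSeries, if_neg, zero_mul]
    rintro ⟨j, rfl⟩
    apply hi'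
    refine ⟨j, ?_, rfl⟩
    rw [mem_range] at hi
    simp only [coe_range, Set.mem_Iio]
    rw [Nat.lt_succ_iff, Nat.le_div_iff_mul_le hd]
    lia
  · intro j _
    rw [coeff_expSeries, if_pos (dvd_mul_right d j), Nat.mul_div_cancel_left _ hd, mul_comm]

theorem norm_pow_div_factorial_le_one {a n : ℕ} (h : n ≤ a + 1) :
    ‖(p : ℚ_[p]) ^ a / n.factorial‖ ≤ 1 := by
  have hv : padicValNat p n.factorial ≤ a := by
    rcases Nat.eq_zero_or_pos n with rfl | hn
    · simp
    · have := padicValNat_factorial_lt_of_ne_zero (p := p) hn.ne'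
      lia
  rw [norm_div, Padic.norm_p_pow, Padic.norm_eq_zpow_neg_valuation
    (Nat.cast_ne_zero.2 n.factorial_ne_zero), Padic.valuation_natCast]
  have hp1 : (1 : ℝ) < p := mod_cast hp.out.one_lt
  rw [div_le_one (zpow_pos (by linarith) _)]
  exact zpow_le_zpow_right₀ hp1.le (by lia)

/-- Dwork's integrality criterion, for the coefficients of degree below `M`. -/
theorem norm_coeff_le_one_of_pow_mul_eq {f u v : PowerSeries ℚ_[p]} {M : ℕ}
    (hf : coeff 0 f = 1) (hu0 : coeff 0 u = 1) (hu : ∀ n, 0 < n → n < M → coeff n u = 0)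
    (hv0 : coeff 0 v = 1) (hv : ∀ n, 0 < n → ∃ y : ℤ_[p], coeff n v = p * y)
    (h : f ^ p * u = PowerSeries.expand p hp.out.ne_zero f * v) :
    ∀ m < M, ‖coeff m f‖ ≤ 1 := by
  intro m
  induction m using Nat.strong_induction_on with
  | _ m ih =>
  intro hm
  rcases Nat.eq_zero_or_pos m with rfl | hm0
  · rw [hf]; simp
  have hp0 : (p : ℚ_[p]) ≠ 0 := mod_cast hp.out.ne_zero
  have hlift : ∀ i, ∃ y : ℤ_[p], i < m → (y : ℚ_[p]) = coeff i f := by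
    intro i
    by_cases hi : i < m
    · exact ⟨⟨coeff i f, ih i hi (hi.trans hm)⟩, fun _ => rfl⟩
    · exact ⟨0, fun h => absurd h hi⟩
  choose c hc using hlift
  -- Truncating `f` below degree `m` leaves integral coefficients by induction, so the Frobenius
  -- congruence applies.
  let G : Polynomial ℤ_[p] := ∑ i ∈ range m, Polynomial.monomial i (c i)
  have hG : ∀ i, G.coeff i = if i < m then c i else 0 := by
    intro i
    simp [G, Polynomial.coeff_monomial]
  obtain ⟨K, hK⟩ := Polynomial.exists_pow_eq_expand_add G
  let φ : ℤ_[p] →+* ℚ_[p] := PadicInt.Coe.ringHom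
  let g : PowerSeries ℚ_[p] := ((G.map φ : Polynomial ℚ_[p]) : PowerSeries ℚ_[p])
  have hg : ∀ i, coeff i g = if i < m then coeff i f else 0 := by
    intro i
    rw [Polynomial.coeff_coe, Polynomial.coeff_map, hG]
    split_ifs with hi
    · exact hc i hi
    · simp
  have hgp : coeff m (g ^ p) =
      coeff m (PowerSeries.expand p hp.out.ne_zero f) + p * (K.coeff m : ℚ_[p]) := by
    have : g ^ p = (((G ^ p).map φ : Polynomial ℚ_[p]) : PowerSeries ℚ_[p]) := by
      simp [g]
    rw [this, hK, Polynomial.coeff_coe, Polynomial.coeff_map, Polynomial.coeff_add,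
      Polynomial.coeff_C_mul, map_add, map_mul, map_natCast, Polynomial.coeff_expand hp.out.pos,
      PowerSeries.coeff_expand]
    congr 1
    split_ifs with hd
    · have hlt : m / p < m := Nat.div_lt_self hm0 hp.out.one_lt
      rw [hG, if_pos hlt]
      exact hc _ hlt
    · simp
  -- Expand `(g + X^m q)^p`: the linear term contributes `p` times the top coefficient, and the rest
  -- starts in degree `2m > m`.
  have hfp : coeff m (f ^ p) = coeff m (g ^ p) + p * coeff m f := by
    obtain ⟨q, hq⟩ : X ^ m ∣ f - g := by
      rw [X_pow_dvd_iff]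
      intro i hi
      rw [map_sub, hg, if_pos hi, sub_self]
    have hq0 : coeff 0 q = coeff m f := by
      have := congrArg (coeff m) hq
      rw [map_sub, hg, if_neg (lt_irrefl m), sub_zero] at this
      rw [this, coeff_X_pow_mul']
      simp
    have hfg : f = g + X ^ m * q := by rw [← hq]; ring
    obtain ⟨k, hk⟩ := Polynomial.powAddExpansion g (X ^ m * q) p
    have hg0 : constantCoeff g = 1 := by
      rw [← coeff_zero_eq_constantCoeff_apply, hg, if_pos hm0, hf]
    have e1 : (p : PowerSeries ℚ_[p]) * g ^ (p - 1) * (X ^ m * q) =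
        X ^ m * (C (p : ℚ_[p]) * (g ^ (p - 1) * q)) := by
      rw [map_natCast]; ring
    have e2 : k * (X ^ m * q) ^ 2 = X ^ m * (X ^ m * (k * q ^ 2)) := by ring
    conv_lhs => rw [hfg, hk, e1, e2]
    rw [map_add, map_add, coeff_X_pow_mul', coeff_X_pow_mul', if_pos le_rfl, if_pos le_rfl,
      Nat.sub_self, coeff_X_pow_mul', if_neg (by lia), coeff_C_mul]
    rw [← hq0]
    simp [hg0]
  have hL : coeff m (f ^ p * u) = coeff m (f ^ p) := by
    rw [coeff_mul, sum_eq_single (m, 0)]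
    · rw [hu0, mul_one]
    · rintro ⟨i, j⟩ hij hne
      rw [HasAntidiagonal.mem_antidiagonal] at hij
      simp only at hij
      have hj : 0 < j := by
        rcases Nat.eq_zero_or_pos j with rfl | hj
        · exact absurd (by simp [← hij]) hne
        · exact hj
      rw [hu j hj (by lia), mul_zero]
    · intro h; simp at h
  have hR : ∃ y : ℤ_[p], coeff m (PowerSeries.expand p hp.out.ne_zero f * v) =
      coeff m (PowerSeries.expand p hp.out.ne_zero f) + p * y := by
    have hex : ∀ i < m, ∃ y : ℤ_[p], coeff i (PowerSeries.expand p hp.out.ne_zero f) = y := by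
      intro i hi
      rw [PowerSeries.coeff_expand]
      split_ifs
      · exact ⟨c (i / p), (hc _ ((Nat.div_le_self _ _).trans_lt hi)).symm⟩
      · exact ⟨0, by simp⟩
    rw [coeff_mul, Nat.sum_antidiagonal_eq_sum_range_succ
      (fun i j => coeff i (PowerSeries.expand p hp.out.ne_zero f) * coeff j v), sum_range_succ,
      Nat.sub_self, hv0, mul_one]
    have : ∀ i : ℕ, ∃ y : ℤ_[p], i < m →
        coeff i (PowerSeries.expand p hp.out.ne_zero f) * coeff (m - i) v = p * y := by
      intro i
      by_cases hi : i < m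
      · obtain ⟨y, hy⟩ := hex i hi
        obtain ⟨z, hz⟩ := hv (m - i) (by lia)
        exact ⟨y * z, fun _ => by rw [hy, hz]; push_cast; ring⟩
      · exact ⟨0, fun h => absurd h hi⟩
    choose y hy using this
    refine ⟨∑ i ∈ range m, y i, ?_⟩
    rw [add_comm, PadicInt.coe_sum, mul_sum]
    congr 1
    exact sum_congr rfl fun i hi => hy i (mem_range.1 hi)
  obtain ⟨y, hy⟩ := hR
  -- In degree `m` the terms from `f(X^p)` cancel, and everything left is divisible by `p`.
  have key : coeff m f = ((y - K.coeff m : ℤ_[p]) : ℚ_[p]) := by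
    have h1 := congrArg (coeff m) h
    rw [hL, hfp, hgp, hy] at h1
    apply mul_left_cancel₀ hp0
    push_cast
    linear_combination h1
  rw [key]
  exact PadicInt.norm_le_one _

end

/-! ### Truncated Artin–Hasse exponentials and their denominators -/

section
variable {p : ℕ} [hp : Fact p.Prime]
open PowerSeries Finset

theorem expSeries_congr {d e : ℕ} [NeZero d] [NeZero e] (h : d = e) {a b : ℚ_[p]} (hab : a = b) :
    expSeries p d a = expSeries p e b := by
  subst h hab; rfl

/-- The truncated Artin–Hasse exponential `exp (∑ j < N, X ^ p ^ j / p ^ j)`. -/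
noncomputable def truncArtinHasse (p : ℕ) [Fact p.Prime] (N : ℕ) : PowerSeries ℚ_[p] :=
  ∏ j ∈ range N, expSeries p (p ^ j) ((p : ℚ_[p]) ^ j)⁻¹

/-- The exponents telescope. The extra factor on the left is `1` below degree `p^N`, which is why
Dwork's criterion is stated with a bound `M`. -/
theorem truncArtinHasse_pow_mul (N : ℕ) :
    truncArtinHasse p N ^ p * expSeries p (p ^ N) (p * ((p : ℚ_[p]) ^ N)⁻¹) =
      PowerSeries.expand p hp.out.ne_zero (truncArtinHasse p N) * expSeries p 1 p := by
  have hp0 : (p : ℚ_[p]) ≠ 0 := mod_cast hp.out.ne_zero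
  rw [truncArtinHasse, ← prod_pow, map_prod]
  simp only [expSeries_pow]
  rw [← prod_range_succ (fun j => expSeries p (p ^ j) (p * ((p : ℚ_[p]) ^ j)⁻¹)), prod_range_succ']
  congr 1
  · refine prod_congr rfl fun j _ => ?_
    rw [expand_expSeries]
    refine expSeries_congr (pow_succ' p j) ?_
    rw [pow_succ']
    field_simp
  · exact expSeries_congr (pow_zero p) (by simp)

theorem norm_coeff_truncArtinHasse_le_one {N m : ℕ} (hm : m < p ^ N) :
    ‖coeff m (truncArtinHasse p N)‖ ≤ 1 := by
  refine norm_coeff_le_one_of_pow_mul_eq (M := p ^ N) ?_ ?_ ?_ ?_ ?_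
    (truncArtinHasse_pow_mul N) m hm
  · rw [coeff_zero_eq_constantCoeff_apply, truncArtinHasse, map_prod]
    refine prod_eq_one fun j _ => ?_
    rw [← coeff_zero_eq_constantCoeff_apply, coeff_expSeries]
    simp
  · simp [coeff_expSeries]
  · intro n hn hn'
    rw [coeff_expSeries, if_neg]
    exact fun h => absurd (Nat.le_of_dvd hn h) (by lia)
  · simp [coeff_expSeries]
  · intro n hn
    obtain ⟨n, rfl⟩ := Nat.exists_eq_add_of_lt hn
    refine ⟨⟨(p : ℚ_[p]) ^ n / (n + 1).factorial, norm_pow_div_factorial_le_one le_rfl⟩, ?_⟩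
    simp only [coeff_expSeries, one_dvd, if_true, Nat.div_one, zero_add]
    ring

/-- The `m`-th coefficient of `f` has denominator at most `p ^ (2 * (m / p ^ 2))`, for `m < M`. -/
def HasSmallDenominators (M : ℕ) (f : PowerSeries ℚ_[p]) : Prop :=
  ∀ m < M, ‖(p : ℚ_[p]) ^ (2 * (m / p ^ 2)) * coeff m f‖ ≤ 1

theorem HasSmallDenominators.mul {M : ℕ} {f g : PowerSeries ℚ_[p]}
    (hf : HasSmallDenominators M f) (hg : HasSmallDenominators M g) :
    HasSmallDenominators M (f * g) := by
  intro m hm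
  rw [coeff_mul, mul_sum]
  refine IsUltrametricDist.norm_sum_le_of_forall_le_of_nonneg zero_le_one ?_
  rintro ⟨i, j⟩ hij
  rw [HasAntidiagonal.mem_antidiagonal] at hij
  simp only at hij ⊢
  have hle : i / p ^ 2 + j / p ^ 2 ≤ m / p ^ 2 := hij ▸ Nat.div_add_div_le_add_div
  obtain ⟨t, ht⟩ := Nat.exists_eq_add_of_le hle
  have e : (p : ℚ_[p]) ^ (2 * (m / p ^ 2)) * (coeff i f * coeff j g) =
      (p : ℚ_[p]) ^ (2 * t) * (((p : ℚ_[p]) ^ (2 * (i / p ^ 2)) * coeff i f) *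
        ((p : ℚ_[p]) ^ (2 * (j / p ^ 2)) * coeff j g)) := by
    rw [ht]; ring
  rw [e, norm_mul, norm_mul]
  have h1 : ‖(p : ℚ_[p]) ^ (2 * t)‖ ≤ 1 := by
    rw [norm_pow]
    exact pow_le_one₀ (norm_nonneg _) Padic.norm_p_lt_one.le
  exact mul_le_one₀ h1 (by positivity)
    (mul_le_one₀ (hf i (by lia)) (norm_nonneg _) (hg j (by lia)))

theorem hasSmallDenominators_expSeries (M i : ℕ) :
    HasSmallDenominators M (expSeries p (p ^ (i + 3)) (-((p : ℚ_[p]) ^ (i + 3))⁻¹)) := by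
  intro m _
  have hp0 : (p : ℚ_[p]) ≠ 0 := mod_cast hp.out.ne_zero
  rw [coeff_expSeries]
  split_ifs with h
  · obtain ⟨t, rfl⟩ := h
    have e1 : p ^ (i + 3) * t / p ^ 2 = p ^ (i + 1) * t := by
      rw [show p ^ (i + 3) * t = p ^ 2 * (p ^ (i + 1) * t) by ring]
      exact Nat.mul_div_cancel_left _ (pow_pos hp.out.pos 2)
    rw [e1, Nat.mul_div_cancel_left _ (pow_pos hp.out.pos _)]
    -- Per unit of `t`, `i + 3` powers of `p` clear the denominator of the exponent and one more
    -- absorbs `t!`.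
    have hge : i + 4 ≤ 2 * p ^ (i + 1) := by
      have h1 : 2 ^ (i + 1) ≤ p ^ (i + 1) := Nat.pow_le_pow_left hp.out.two_le _
      have h2 : i + 1 < 2 ^ (i + 1) := Nat.lt_two_pow_self
      lia
    obtain ⟨s, hs⟩ := Nat.exists_eq_add_of_le hge
    have e2 : 2 * (p ^ (i + 1) * t) = (i + 3) * t + (t + s * t) := by
      rw [← mul_assoc, hs]; ring
    have e3 : (p : ℚ_[p]) ^ (2 * (p ^ (i + 1) * t)) *
        ((-((p : ℚ_[p]) ^ (i + 3))⁻¹) ^ t / t.factorial) =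
        (-1) ^ t * ((p : ℚ_[p]) ^ (t + s * t) / t.factorial) := by
      rw [e2, pow_add _ ((i + 3) * t), neg_pow ((p ^ (i + 3) : ℚ_[p])⁻¹), inv_pow, ← pow_mul]
      field_simp
    rw [e3, norm_mul, norm_pow, norm_neg, norm_one, one_pow, one_mul]
    exact norm_pow_div_factorial_le_one (by lia)
  · simp

theorem truncArtinHasse_three_eq (N : ℕ) :
    truncArtinHasse p 3 = truncArtinHasse p (N + 3) *
      ∏ i ∈ range N, expSeries p (p ^ (i + 3)) (-((p : ℚ_[p]) ^ (i + 3))⁻¹) := by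
  induction N with
  | zero => simp
  | succ N ih =>
    have h : truncArtinHasse p (N + 1 + 3) = truncArtinHasse p (N + 3) *
        expSeries p (p ^ (N + 3)) ((p : ℚ_[p]) ^ (N + 3))⁻¹ := by
      rw [truncArtinHasse, show N + 1 + 3 = (N + 3) + 1 by ring, prod_range_succ]; rfl
    rw [h, prod_range_succ, mul_mul_mul_comm, ← ih, expSeries_mul, add_neg_cancel, expSeries_zero,
      mul_one]

theorem norm_coeff_truncArtinHasse_three_le_one (m : ℕ) :
    ‖(p : ℚ_[p]) ^ (2 * (m / p ^ 2)) * coeff m (truncArtinHasse p 3)‖ ≤ 1 := by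
  have hprod : ∀ N M, HasSmallDenominators M
      (∏ i ∈ range N, expSeries p (p ^ (i + 3)) (-((p : ℚ_[p]) ^ (i + 3))⁻¹)) := by
    intro N M
    induction N with
    | zero =>
      intro m _
      rw [range_zero, prod_empty, coeff_one]
      split_ifs with h
      · simp [h]
      · simp
    | succ N ih =>
      rw [prod_range_succ]
      exact ih.mul (hasSmallDenominators_expSeries M N)
  -- Truncation at `m + 3` suffices, as `m < p^(m+3)`; no infinite product is needed.
  have hAH : HasSmallDenominators (m + 1) (truncArtinHasse p (m + 3)) := by
    intro k hk
    have hlt : k < p ^ (m + 3) :=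
      calc k < m + 3 := by lia
        _ < p ^ (m + 3) := Nat.lt_pow_self hp.out.one_lt
    rw [norm_mul, norm_pow]
    exact mul_le_one₀ (pow_le_one₀ (norm_nonneg _) Padic.norm_p_lt_one.le) (norm_nonneg _)
      (norm_coeff_truncArtinHasse_le_one hlt)
  rw [truncArtinHasse_three_eq m]
  exact hAH.mul (hprod m (m + 1)) m (Nat.lt_succ_self m)

/-- The `p`-adic integers `p ^ (2 i) c_{p ^ 2 i + r}`, with `c` the coefficients of
`exp (X + X ^ p / p + X ^ p ^ 2 / p ^ 2)`. -/
theorem exists_padicInt_eq_coeff_truncArtinHasse_three {r : ℕ} (hr : r < p ^ 2) (i : ℕ) :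
    ∃ y : ℤ_[p], (y : ℚ_[p]) = (p : ℚ_[p]) ^ (2 * i) *
      coeff (p ^ 2 * i + r) (truncArtinHasse p 3) := by
  have h := norm_coeff_truncArtinHasse_three_le_one (p := p) (p ^ 2 * i + r)
  rw [Nat.mul_add_div (pow_pos hp.out.pos 2), Nat.div_eq_of_lt hr, add_zero] at h
  exact ⟨⟨_, h⟩, rfl⟩

/-! ### Factorials and their prime-to-`p` parts -/

/-- The product of the integers in `[1, n]` that are not divisible by `p`. -/
def primeToFactorial (p n : ℕ) : ℕ := ∏ j ∈ range n, if p ∣ j + 1 then 1 else j + 1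

theorem factorial_eq_pow_mul_primeToFactorial (n : ℕ) :
    n.factorial = p ^ (n / p) * (n / p).factorial * primeToFactorial p n := by
  induction n with
  | zero => simp [primeToFactorial]
  | succ n ih =>
    rw [Nat.factorial_succ, ih, primeToFactorial, primeToFactorial, prod_range_succ, Nat.succ_div]
    split_ifs with h
    · obtain ⟨t, ht⟩ := h
      have e : n / p + 1 = t := by
        have := Nat.succ_div_of_dvd (a := n) (b := p) ⟨t, ht⟩
        rw [← this, ht, Nat.mul_div_cancel_left _ hp.out.pos]
      rw [Nat.factorial_succ, e, ht]
      have e' : p ^ t = p ^ (n / p) * p := by rw [← e, pow_succ]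
      rw [e']
      ring
    · rw [add_zero]; ring

theorem factorial_eq_pow_mul_primeToFactorial_mul (k : ℕ) {r : ℕ} (hr : r < p ^ 2) :
    (p ^ 2 * k + r).factorial = p ^ (k * (p - 1)) * p ^ (r / p) * p ^ (2 * k) * k.factorial *
      (primeToFactorial p (p ^ 2 * k + r) * primeToFactorial p (p * k + r / p)) := by
  have h1 : (p ^ 2 * k + r) / p = p * k + r / p := by
    rw [show p ^ 2 * k = p * (p * k) by ring, Nat.mul_add_div hp.out.pos]
  have h2 : (p * k + r / p) / p = k := by
    rw [Nat.mul_add_div hp.out.pos, Nat.div_div_eq_div_mul, ← sq, Nat.div_eq_of_lt hr, add_zero]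
  rw [factorial_eq_pow_mul_primeToFactorial (p := p), h1,
    factorial_eq_pow_mul_primeToFactorial (p := p) (p * k + r / p), h2]
  have e : p * k + r / p + k = k * (p - 1) + r / p + 2 * k := by
    obtain ⟨q, hq⟩ : ∃ q, p = q + 1 := ⟨p - 1, by have := hp.out.pos; lia⟩
    rw [show p - 1 = q by lia]
    nth_rewrite 1 [hq]
    ring
  have e' : p ^ (p * k + r / p) * p ^ k = p ^ (k * (p - 1)) * p ^ (r / p) * p ^ (2 * k) := by
    rw [← pow_add, e, pow_add, pow_add]
  rw [← e']; ring

theorem coprime_primeToFactorial (n : ℕ) : Nat.Coprime (primeToFactorial p n) p := by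
  refine Nat.Coprime.prod_left fun j _ => ?_
  split_ifs with h
  · simp
  · exact ((Nat.Prime.coprime_iff_not_dvd hp.out).2 h).symm

/-- Each block of `p^w` consecutive integers contributes the same unit modulo `p^w`; Euler's theorem
kills a number of blocks divisible by the totient. -/
theorem primeToFactorial_add_modEq (w n s : ℕ) (hw : 1 ≤ w) :
    primeToFactorial p (n + p ^ w * (s * (p ^ w).totient)) ≡ primeToFactorial p n [MOD p ^ w] := by
  have hper : ∀ t n, primeToFactorial p (n + p ^ w * t) ≡
      primeToFactorial p n * primeToFactorial p (p ^ w) ^ t [MOD p ^ w] := by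
    have hpd : p ∣ p ^ w := dvd_pow_self p (by lia)
    have hone : ∀ n, primeToFactorial p (p ^ w + n) ≡
        primeToFactorial p (p ^ w) * primeToFactorial p n [MOD p ^ w] := by
      intro n
      rw [primeToFactorial, prod_range_add]
      refine Nat.ModEq.mul_left _ ?_
      rw [primeToFactorial]
      induction n with
      | zero => rfl
      | succ n ih =>
        rw [prod_range_succ, prod_range_succ]
        refine ih.mul ?_
        simp only [add_assoc, Nat.dvd_add_right hpd]
        split_ifs
        · rfl
        · simp [Nat.ModEq]
    intro t
    induction t with
    | zero => intro n; simp; rfl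
    | succ t ih =>
      intro n
      have h1 := hone (n + p ^ w * t)
      rw [show n + p ^ w * (t + 1) = p ^ w + (n + p ^ w * t) by ring]
      refine h1.trans (((ih n).mul_left _).trans ?_)
      rw [pow_succ]
      exact congrArg (· % p ^ w) (by ring)
  refine (hper _ n).trans ?_
  have h := Nat.ModEq.pow_totient ((coprime_primeToFactorial (p := p) (p ^ w)).pow_right w)
  rw [mul_comm s, pow_mul]
  simpa using (h.pow s).mul_left (primeToFactorial p n)

end

/-! ### Counting by cycle type -/

section
open Finset Equiv

theorem isProdDisjointCycles_iff {d n : ℕ} (σ : Perm (Fin n)) :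
    IsProdDisjointCycles d σ ↔ ∀ c ∈ σ.cycleType, c = d := by
  constructor
  · rintro ⟨l, hl, hd, hprod⟩ c hc
    rw [Perm.cycleType_eq l hprod (fun τ h => (hl τ h).1) hd] at hc
    obtain ⟨τ, hτ, rfl⟩ := List.mem_map.1 (Multiset.mem_coe.1 hc)
    exact (hl τ hτ).2
  · intro h
    obtain ⟨l, hprod, hc, hd⟩ := σ.truncCycleFactors.out
    refine ⟨l, fun τ hτ => ⟨hc τ hτ, h _ ?_⟩, hd, hprod⟩
    rw [Perm.cycleType_eq l hprod hc hd]
    exact Multiset.mem_coe.2 (List.mem_map.2 ⟨τ, hτ, rfl⟩)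

theorem cycleProdCount_eq_sum {d : ℕ} (hd : 2 ≤ d) (n : ℕ) :
    cycleProdCount d n = ∑ j ∈ range (n / d + 1),
      #({σ : Perm (Fin n) | σ.cycleType = Multiset.replicate j d} : Finset (Perm (Fin n))) := by
  classical
  rw [cycleProdCount, Nat.card_eq_fintype_card, Fintype.card_subtype]
  rw [card_eq_sum_card_fiberwise (f := fun σ => σ.cycleType.card) (t := range (n / d + 1))]
  · refine sum_congr rfl fun j _ => ?_
    congr 1
    ext σ
    simp only [mem_filter, mem_univ, true_and, isProdDisjointCycles_iff, Multiset.eq_replicate]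
    tauto
  · intro σ hσ
    have h := (isProdDisjointCycles_iff σ).1 (by simpa using hσ)
    have hs : σ.cycleType.sum ≤ n := by
      rw [Perm.sum_cycleType]; simpa using σ.support.card_le_univ
    rw [Multiset.eq_replicate_of_mem h, Multiset.sum_replicate, smul_eq_mul] at hs
    simp only [coe_range, Set.mem_Iio, Nat.lt_succ_iff]
    exact (Nat.le_div_iff_mul_le (by lia)).2 hs

theorem card_cycleType_replicate_mul {d : ℕ} (hd : 2 ≤ d) {n j : ℕ} (hj : d * j ≤ n) :
    #({σ : Perm (Fin n) | σ.cycleType = Multiset.replicate j d} : Finset (Perm (Fin n))) *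
      ((n - d * j).factorial * d ^ j * j.factorial) = n.factorial := by
  have h := Perm.card_of_cycleType_mul_eq (Fin n) (Multiset.replicate j d)
  rw [if_pos] at h
  · rw [Fintype.card_fin, Multiset.sum_replicate, smul_eq_mul, Multiset.prod_replicate,
      mul_comm j d] at h
    rw [← h]
    congr 2
    rcases Nat.eq_zero_or_pos j with rfl | hj0
    · simp
    · rw [Multiset.toFinset_replicate, if_neg hj0.ne', prod_singleton, Multiset.count_replicate_self]
  · refine ⟨?_, fun a ha => ?_⟩
    · rw [Multiset.sum_replicate, smul_eq_mul, mul_comm]; simpa using hj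
    · rw [Multiset.eq_of_mem_replicate ha]; exact hd

end

/-! ### The quotient as a `p`-adic integer -/

section
variable {p : ℕ} [hp : Fact p.Prime]
open PowerSeries Finset

theorem cycleProdCount_eq_factorial_mul_coeff (n : ℕ) :
    (cycleProdCount p n : ℚ_[p]) = n.factorial * coeff n (truncArtinHasse p 2) := by
  have hp0 : (p : ℚ_[p]) ≠ 0 := mod_cast hp.out.ne_zero
  have h2 : truncArtinHasse p 2 = expSeries p 1 1 * expSeries p p (p : ℚ_[p])⁻¹ := by
    rw [truncArtinHasse, prod_range_succ, prod_range_one]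
    congr 1
    · exact expSeries_congr (pow_zero p) (by simp)
    · exact expSeries_congr (pow_one p) (by simp)
  rw [h2, coeff_mul_expSeries, cycleProdCount_eq_sum hp.out.two_le, mul_sum, Nat.cast_sum]
  refine sum_congr rfl fun j hj => ?_
  have hj' : p * j ≤ n := by
    rw [mem_range, Nat.lt_succ_iff, Nat.le_div_iff_mul_le hp.out.pos] at hj
    lia
  have h := congrArg (Nat.cast (R := ℚ_[p])) (card_cycleType_replicate_mul hp.out.two_le hj')
  rw [← h, coeff_expSeries, if_pos (one_dvd _), Nat.div_one]
  have h1 : ((n - p * j).factorial : ℚ_[p]) ≠ 0 := Nat.cast_ne_zero.2 (Nat.factorial_ne_zero _)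
  have h2 : (j.factorial : ℚ_[p]) ≠ 0 := Nat.cast_ne_zero.2 (Nat.factorial_ne_zero _)
  push_cast
  rw [one_pow, inv_pow]
  field_simp

theorem coeff_truncArtinHasse_two (k : ℕ) {r : ℕ} (hr : r < p ^ 2) :
    coeff (p ^ 2 * k + r) (truncArtinHasse p 2) =
      ∑ i ∈ range (k + 1), coeff (p ^ 2 * i + r) (truncArtinHasse p 3) *
        ((-((p : ℚ_[p]) ^ 2)⁻¹) ^ (k - i) / (k - i).factorial) := by
  have h : truncArtinHasse p 2 =
      truncArtinHasse p 3 * expSeries p (p ^ 2) (-((p : ℚ_[p]) ^ 2)⁻¹) := by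
    have h3 : truncArtinHasse p 3 =
        truncArtinHasse p 2 * expSeries p (p ^ 2) ((p : ℚ_[p]) ^ 2)⁻¹ := by
      rw [truncArtinHasse, prod_range_succ]; rfl
    rw [h3, mul_assoc, expSeries_mul, add_neg_cancel, expSeries_zero, mul_one]
  rw [h, coeff_mul_expSeries, Nat.mul_add_div (pow_pos hp.out.pos 2), Nat.div_eq_of_lt hr, add_zero,
    ← sum_range_reflect]
  refine sum_congr rfl fun i hi => ?_
  have hi' : i ≤ k := Nat.lt_succ_iff.1 (mem_range.1 hi)
  obtain ⟨t, rfl⟩ := Nat.exists_eq_add_of_le hi'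
  have e : p ^ 2 * (i + t) + r - p ^ 2 * (i + t + 1 - 1 - i) = p ^ 2 * i + r := by
    rw [show i + t + 1 - 1 - i = t by lia, mul_add]; lia
  rw [e, show i + t + 1 - 1 - i = i + t - i by lia]

/-- The quotient of `cycleProdCount p (p ^ 2 * k + r)` by `p ^ (k * (p - 1))`, in terms of the
`p`-adic integers `d i = p ^ (2 i) c_{p ^ 2 i + r}`. -/
noncomputable def quotientFormula (p : ℕ) [Fact p.Prime] (r : ℕ) (d : ℕ → ℤ_[p]) (k : ℕ) : ℤ_[p] :=
  p ^ (r / p) *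
    ((primeToFactorial p (p ^ 2 * k + r) * primeToFactorial p (p * k + r / p) : ℕ) : ℤ_[p]) *
    ((-1) ^ k * ∑ i ∈ range (k + 1), (k.descFactorial i : ℤ_[p]) * ((-1) ^ i * d i))

theorem exists_cycleProdCount_eq {r : ℕ} (hr : r < p ^ 2) : ∃ d : ℕ → ℤ_[p], ∀ k,
    (cycleProdCount p (p ^ 2 * k + r) : ℤ_[p]) = p ^ (k * (p - 1)) * quotientFormula p r d k := by
  have hp0 : (p : ℚ_[p]) ≠ 0 := mod_cast hp.out.ne_zero
  choose d hd using exists_padicInt_eq_coeff_truncArtinHasse_three (p := p) hr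
  refine ⟨d, fun k => ?_⟩
  apply PadicInt.ext
  have hsum : (p : ℚ_[p]) ^ (2 * k) * k.factorial * coeff (p ^ 2 * k + r) (truncArtinHasse p 2) =
      (-1) ^ k * ∑ i ∈ range (k + 1), (k.descFactorial i : ℚ_[p]) * ((-1) ^ i * (d i : ℚ_[p])) := by
    rw [coeff_truncArtinHasse_two k hr, mul_sum, mul_sum]
    refine sum_congr rfl fun i hi => ?_
    have hi' : i ≤ k := Nat.lt_succ_iff.1 (mem_range.1 hi)
    obtain ⟨t, rfl⟩ := Nat.exists_eq_add_of_le hi'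
    have hf := congrArg (Nat.cast (R := ℚ_[p])) (Nat.factorial_mul_descFactorial hi')
    rw [hd, ← hf, Nat.add_sub_cancel_left]
    have h1 : (t.factorial : ℚ_[p]) ≠ 0 := Nat.cast_ne_zero.2 (Nat.factorial_ne_zero _)
    have h2 : ((-1 : ℚ_[p]) ^ i) * (-1) ^ i = 1 := by rw [← mul_pow]; simp
    push_cast
    rw [neg_pow (((p : ℚ_[p]) ^ 2)⁻¹), inv_pow, ← pow_mul, mul_add, pow_add _ (2 * i), pow_add (-1)]
    field_simp
    linear_combination (-coeff (p ^ 2 * i + r) (truncArtinHasse p 3)) * h2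
  rw [quotientFormula, PadicInt.coe_mul, PadicInt.coe_mul, PadicInt.coe_mul ((-1) ^ k),
    PadicInt.coe_sum]
  push_cast
  rw [cycleProdCount_eq_factorial_mul_coeff, factorial_eq_pow_mul_primeToFactorial_mul k hr, ← hsum]
  push_cast
  ring

theorem quotientFormula_add_sub_dvd (r : ℕ) (d : ℕ → ℤ_[p]) {w T : ℕ} (hw : 1 ≤ w) (hT : Even T)
    (hT' : p ^ w * (p ^ w).totient ∣ p * T) (hT'' : p ^ w ∣ T) (k : ℕ) :
    (p : ℤ_[p]) ^ w ∣ quotientFormula p r d (k + T) - quotientFormula p r d k := by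
  have hcast : ∀ {a b : ℕ}, a ≡ b [MOD p ^ w] → (p : ℤ_[p]) ^ w ∣ (a : ℤ_[p]) - b := by
    intro a b hab
    have h := (Nat.modEq_iff_dvd.1 hab.symm)
    have h' := (PadicInt.pow_p_dvd_int_iff (p := p) w ((a : ℤ) - b)).2 (by exact_mod_cast h)
    simpa using h'
  obtain ⟨s, hs⟩ := hT'
  have e1 : p ^ 2 * (k + T) + r = (p ^ 2 * k + r) + p ^ w * ((p * s) * (p ^ w).totient) := by
    linear_combination p * hs
  have e2 : p * (k + T) + r / p = (p * k + r / p) + p ^ w * (s * (p ^ w).totient) := by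
    linear_combination hs
  have hU : primeToFactorial p (p ^ 2 * (k + T) + r) * primeToFactorial p (p * (k + T) + r / p) ≡
      primeToFactorial p (p ^ 2 * k + r) * primeToFactorial p (p * k + r / p) [MOD p ^ w] := by
    rw [e1, e2]
    exact (primeToFactorial_add_modEq w _ _ hw).mul (primeToFactorial_add_modEq w _ _ hw)
  -- Terms with `i > k` vanish, so both sums can share one range.
  have hext : ∑ i ∈ range (k + 1), (k.descFactorial i : ℤ_[p]) * ((-1) ^ i * d i) =
      ∑ i ∈ range (k + T + 1), (k.descFactorial i : ℤ_[p]) * ((-1) ^ i * d i) := by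
    refine sum_subset (fun x hx => mem_range.2 (by rw [mem_range] at hx; lia)) fun i _ hi => ?_
    have hki : k < i := by rw [Finset.mem_range] at hi; lia
    rw [Nat.descFactorial_of_lt hki, Nat.cast_zero, zero_mul]
  -- The descending factorial is an integer polynomial in `k`, and `p^w ∣ T`.
  have hdesc : ∀ i, (p : ℤ_[p]) ^ w ∣ ((k + T).descFactorial i : ℤ_[p]) - k.descFactorial i := by
    intro i
    rw [← descPochhammer_eval_eq_descFactorial, ← descPochhammer_eval_eq_descFactorial]
    refine dvd_trans ?_ (Polynomial.sub_dvd_eval_sub _ _ _)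
    rw [Nat.cast_add, add_sub_cancel_left, ← Nat.cast_pow]
    exact Nat.cast_dvd_cast hT''
  have hS : (p : ℤ_[p]) ^ w ∣
      ∑ i ∈ range (k + T + 1), ((k + T).descFactorial i : ℤ_[p]) * ((-1) ^ i * d i) -
      ∑ i ∈ range (k + T + 1), (k.descFactorial i : ℤ_[p]) * ((-1) ^ i * d i) := by
    rw [← sum_sub_distrib]
    refine dvd_sum fun i _ => ?_
    rw [← sub_mul]
    exact (hdesc i).mul_right _
  have hU' := hcast hU
  rw [quotientFormula, quotientFormula, hext, pow_add (-1) k, hT.neg_one_pow, mul_one]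
  generalize ((primeToFactorial p (p ^ 2 * (k + T) + r) *
    primeToFactorial p (p * (k + T) + r / p) : ℕ) : ℤ_[p]) = u' at hU' ⊢
  generalize ((primeToFactorial p (p ^ 2 * k + r) *
    primeToFactorial p (p * k + r / p) : ℕ) : ℤ_[p]) = u at hU' ⊢
  generalize ∑ i ∈ range (k + T + 1), ((k + T).descFactorial i : ℤ_[p]) * ((-1) ^ i * d i) = s'
    at hS ⊢
  generalize ∑ i ∈ range (k + T + 1), (k.descFactorial i : ℤ_[p]) * ((-1) ^ i * d i) = s₀ at hS ⊢
  have e : (p : ℤ_[p]) ^ (r / p) * u' * ((-1) ^ k * s') - p ^ (r / p) * u * ((-1) ^ k * s₀) =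
      (p ^ (r / p) * (-1) ^ k * s') * (u' - u) + (p ^ (r / p) * (-1) ^ k * u) * (s' - s₀) := by ring
  rw [e]
  exact dvd_add (hU'.mul_left _) (hS.mul_left _)

end

/-! ### Periodicity -/

theorem mainTheorem6 (p : ℕ) (hp : p.Prime) (w : ℕ) (hw : 1 ≤ w) :
    (∀ n : ℕ, p ^ (n / p ^ 2 * (p - 1)) ∣ cycleProdCount p n) ∧
      Function.Periodic
        (fun n : ℕ => (cycleProdCount p n / p ^ (n / p ^ 2 * (p - 1))) % p ^ w)
        (p ^ (2 * w + 1) * (p - 1)) := by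
  have : Fact p.Prime := ⟨hp⟩
  have hpp : 0 < p ^ 2 := pow_pos hp.pos 2
  have hdvd : ∀ n : ℕ, p ^ (n / p ^ 2 * (p - 1)) ∣ cycleProdCount p n := by
    intro n
    obtain ⟨d, hd⟩ := exists_cycleProdCount_eq (p := p) (Nat.mod_lt n hpp)
    have h := hd (n / p ^ 2)
    rw [Nat.div_add_mod] at h
    have h2 := (PadicInt.pow_p_dvd_int_iff (p := p) (n / p ^ 2 * (p - 1)) (cycleProdCount p n)).1
      ⟨_, by rw [Int.cast_natCast]; exact h⟩
    exact_mod_cast h2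
  refine ⟨hdvd, fun n => ?_⟩
  obtain ⟨v, rfl⟩ := Nat.exists_eq_add_of_le' hw
  obtain ⟨d, hd⟩ := exists_cycleProdCount_eq (p := p) (Nat.mod_lt n hpp)
  -- With `w = v + 1`, `T = p^w φ(p^w)`. Shifting `n` by `p^2 T` fixes `r` and shifts `k` by `T`.
  set T := p ^ (2 * v + 1) * (p - 1) with hTdef
  have hTT : p ^ (2 * (v + 1) + 1) * (p - 1) = p ^ 2 * T := by rw [hTdef]; ring
  have hquot : ∀ m, m % p ^ 2 = n % p ^ 2 →
      ((cycleProdCount p m / p ^ (m / p ^ 2 * (p - 1)) : ℕ) : ℤ_[p]) =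
        quotientFormula p (n % p ^ 2) d (m / p ^ 2) := by
    intro m hm
    have h := hd (m / p ^ 2)
    rw [← hm, Nat.div_add_mod] at h
    obtain ⟨c, hc⟩ := hdvd m
    rw [hc, Nat.mul_div_cancel_left _ (pow_pos hp.pos _), ← hm]
    rw [hc, Nat.cast_mul, Nat.cast_pow] at h
    exact mul_left_cancel₀ (pow_ne_zero _ (mod_cast hp.ne_zero)) h
  have hEven : Even T := by
    rcases hp.eq_two_or_odd' with h2 | hodd
    · rw [hTdef, h2]; exact ((even_two.pow_of_ne_zero (by lia))).mul_right _
    · exact (Nat.Odd.sub_odd hodd odd_one).mul_left _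
  have hd1 : p ^ (v + 1) * (p ^ (v + 1)).totient ∣ p * T := by
    rw [Nat.totient_prime_pow_succ hp]
    exact ⟨p, by rw [hTdef]; ring⟩
  have hd2 : p ^ (v + 1) ∣ T := (pow_dvd_pow p (by lia)).mul_right _
  have hmain := quotientFormula_add_sub_dvd (n % p ^ 2) d hw hEven hd1 hd2 (n / p ^ 2)
  have hdiv : (n + p ^ 2 * T) / p ^ 2 = n / p ^ 2 + T := Nat.add_mul_div_left n T hpp
  rw [← hdiv, ← hquot _ (Nat.add_mul_mod_self_left _ _ _), ← hquot n rfl] at hmain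
  simp only [hTT]
  refine (Nat.modEq_iff_dvd.2 ?_).symm
  rw [Nat.cast_pow]
  refine (PadicInt.pow_p_dvd_int_iff (p := p) (v + 1) _).1 ?_
  rw [Int.cast_sub, Int.cast_natCast, Int.cast_natCast]
  exact hmain
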